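/- Let $t,k,g$ be integers with $t>k\ge 2$ and $g>k$, and put $m_i=(k-1)^i(t-1)^{i-1}$ for $i\ge 1$. Define rooted graphs $G_1,G_2,\dots$ as follows. $G_1$ is the complete graph $K_k$ on a root $x$ and a set $W_1$ of $k-1$ further vertices, labelled $\binom{1}{v}$, $v\in[k-1]$. For $i\ge 2$, $G_i$ is obtained from $G_{i-1}$ by adding, for every $\binom{u}{v}\in W_{i-1}$, $t-1$ new disjoint copies of $K_{k-1}$ all of whose vertices are joined to $\binom uv$; the $v_i$-th vertex of the $u_i$-th copy is labelled $\binom{u\,u_i}{v\,v_i}$, and $W_i$ is the set of all new vertices, so $|W_i|=m_i$. Order $W_q$ lexicographically by the columns $(u_1,v_1),\dots,(u_q,v_q)$ (each column compared lexicographically) and let $\varphi:W_q\to[m_q]$ be the order-preserving bijection. For permutations $\Pi=\{\pi_1,\dots,\pi_t\}\subseteq S_{m_q}$ let $G(t,k,q,\Pi)$ be the simple graph obtained from $t$ disjoint copies $G_q^1,\dots,G_q^t$ of $G_q$ by identifying all $t$ roots to one vertex and, for every $j\in[m_q]$, identifying the $t$ vertices $\varphi^{-1}(\pi_i(j))$ of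 $G_q^i$, $1\le i\le t$, to one vertex. Then there is $q_0$ such that for every $q\ge q_0$ there is a set $\Pi=\{\pi_1,\dots,\pi_t\}$ of $t$ distinct permutations in $S_{m_q}$ for which $G(t,k,q,\Pi)$ is connected, has constant link $tK_{k-1}$ (that is, the open neighbourhood of every vertex induces a graph isomorphic to $t$ disjoint copies of $K_{k-1}$), and contains no cycle of length $h$ for any $k<h<g$. -/

import Mathlib

namespace TreeGluing

/-- The disjoint union `t H` of `t` copies of the graph `H`. -/
def copies {V : Type*} (t : ℕ) (H : SimpleGraph V) : SimpleGraph (Fin t × V) where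
  Adj x y := x.1 = y.1 ∧ H.Adj x.2 y.2
  symm := ⟨fun _ _ h => ⟨h.1.symm, h.2.symm⟩⟩
  loopless := ⟨fun _ h => H.loopless.irrefl _ h.2⟩

/-- `G` has constant link `L`: every open neighbourhood induces a graph isomorphic to `L`. -/
def HasConstantLink {V W : Type*} (G : SimpleGraph V) (L : SimpleGraph W) : Prop :=
  ∀ v : V, Nonempty (G.induce (G.neighborSet v) ≃g L)

/-- `G` contains a cycle of length `h`. -/
def HasCycleOfLength {V : Type*} (G : SimpleGraph V) (h : ℕ) : Prop :=
  ∃ (v : V) (c : G.Walk v v), c.IsCycle ∧ c.length = h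

/-- The (simple) graph obtained from `G` by identifying vertices related by `r`. -/
def identify {V : Type*} (G : SimpleGraph V) (r : V → V → Prop) : SimpleGraph (Quot r) where
  Adj X Y := X ≠ Y ∧ ∃ a b : V, G.Adj a b ∧ Quot.mk r a = X ∧ Quot.mk r b = Y
  symm := ⟨fun _ _ h => ⟨h.1.symm, by
    obtain ⟨a, b, hab, ha, hb⟩ := h.2
    exact ⟨b, a, hab.symm, hb, ha⟩⟩⟩
  loopless := ⟨fun _ h => h.1 rfl⟩

/-- `m_q = (k - 1)^q (t - 1)^(q - 1)`, the number of vertices of level `q ≥ 1`. -/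
def levelSize (t k q : ℕ) : ℕ := (k - 1) ^ q * (t - 1) ^ (q - 1)

/-- A column `(u, v)` of a label (copy `u ∈ [t - 1]` of `K_{k-1}`, vertex `v ∈ [k - 1]` in it, both
numbered from `0`), with the lexicographic order. -/
abbrev Column (t k : ℕ) : Type := Fin (t - 1) ×ₗ Fin (k - 1)

/-- A label is the list of its columns `(u_1, v_1), …, (u_l, v_l)`; its first column comes from the
single copy of `K_{k-1}` at the root, so `u_1` is the first element of `[t - 1]`. The root has the
empty label. -/
def IsLabel {t k : ℕ} (w : List (Column t k)) : Prop :=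
  ∀ c ∈ w.head?, ((ofLex c).1 : ℕ) = 0

/-- The vertices of `G_q`: the root (level `0`) and the vertices of levels `1, …, q`. -/
def TreeVertex (t k q : ℕ) : Type :=
  {w : List (Column t k) // IsLabel w ∧ w.length ≤ q}

/-- The root of `G_q`. -/
def treeRoot (t k q : ℕ) : TreeVertex t k q :=
  ⟨[], by simp [IsLabel]⟩

/-- The tree-like graph `G_q`. The vertex `w (u, v)` is the `v`-th vertex of the `u`-th copy of
`K_{k-1}` attached to `w`: it is adjacent to `w` and to the other vertices of that copy. -/
def treeGraph (t k q : ℕ) : SimpleGraph (TreeVertex t k q) where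
  Adj a b :=
    (∃ c, b.1 = a.1 ++ [c]) ∨ (∃ c, a.1 = b.1 ++ [c]) ∨
    ∃ (p : List (Column t k)) (u : Fin (t - 1)) (v v' : Fin (k - 1)), v ≠ v' ∧
      a.1 = p ++ [toLex (u, v)] ∧ b.1 = p ++ [toLex (u, v')]
  symm := ⟨by
    rintro a b (h | h | ⟨p, u, v, v', hv, ha, hb⟩)
    · exact Or.inr (Or.inl h)
    · exact Or.inl h
    · exact Or.inr (Or.inr ⟨p, u, v', v, hv.symm, hb, ha⟩)⟩
  loopless := ⟨by
    rintro a (⟨c, h⟩ | ⟨c, h⟩ | ⟨p, u, v, v', hv, ha, hb⟩)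
    · simpa using congrArg List.length h
    · simpa using congrArg List.length h
    · rw [ha] at hb
      simp at hb
      exact hv hb⟩

/-- The set `W_q` of labels of level `q`, with the lexicographic order of lists of columns. -/
abbrev Level (t k q : ℕ) : Type :=
  {w : List (Column t k) // IsLabel w ∧ w.length = q}

/-- A vertex of the last level, as a vertex of `G_q`. -/
def Level.toVertex {t k q : ℕ} (w : Level t k q) : TreeVertex t k q :=
  ⟨w.1, w.2.1, w.2.2.le⟩

/-- A label of positive level: its first vertex index and its remaining columns. -/
def levelSuccEquiv {t : ℕ} (ht : 2 ≤ t) (k n : ℕ) :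
    Level t k (n + 1) ≃ Fin (k - 1) × List.Vector (Column t k) n where
  toFun w := ((ofLex (w.1.head (List.ne_nil_of_length_eq_add_one w.2.2))).2,
    ⟨w.1.tail, by simp [w.2.2]⟩)
  invFun x := ⟨toLex (⟨0, by omega⟩, x.1) :: x.2.1, by simp [IsLabel], by simp⟩
  left_inv := by
    rintro ⟨_ | ⟨c, l⟩, h, hl⟩
    · simp at hl
    · have h0 : ((ofLex c).1 : ℕ) = 0 := h c (by simp)
      apply Subtype.ext
      simp only [List.head_cons, List.tail_cons, List.cons.injEq, and_true]
      apply ofLex.injective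
      exact Prod.ext (Fin.ext (by simpa using h0.symm)) rfl
  right_inv := by
    rintro ⟨v, l, hl⟩
    rfl

theorem level_finite_card {t : ℕ} (ht : 2 ≤ t) (k q : ℕ) :
    Finite (Level t k q) ∧ Nat.card (Level t k q) = levelSize t k q := by
  cases q with
  | zero =>
    have : Unique (Level t k 0) :=
      { default := ⟨[], by simp [IsLabel]⟩
        uniq := fun w => Subtype.ext (List.length_eq_zero_iff.mp w.2.2) }
    exact ⟨inferInstance, by simp [levelSize]⟩
  | succ n =>
    have : Fintype (Column t k) := inferInstanceAs (Fintype (Fin (t - 1) × Fin (k - 1)))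
    have hc : Fintype.card (Column t k) = (t - 1) * (k - 1) := by
      rw [← Nat.card_eq_fintype_card]
      exact (Nat.card_congr ofLex).trans (by simp)
    refine ⟨Finite.of_equiv _ (levelSuccEquiv ht k n).symm, ?_⟩
    rw [Nat.card_congr (levelSuccEquiv ht k n), Nat.card_eq_fintype_card, Fintype.card_prod,
      card_vector, hc, Fintype.card_fin, levelSize, mul_pow]
    simp only [Nat.add_sub_cancel]
    ring

/-- The order preserving bijection `φ` between `W_q` and `[m_q]` (numbered from `0`). -/
noncomputable def levelOrder {t : ℕ} (ht : 2 ≤ t) (k q : ℕ) :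
    Level t k q ≃o Fin (levelSize t k q) :=
  haveI := (level_finite_card ht k q).1
  letI := Fintype.ofFinite (Level t k q)
  (Fintype.orderIsoFinOfCardEq (Level t k q)
    (Nat.card_eq_fintype_card.symm.trans (level_finite_card ht k q).2)).symm

/-- The identifications made in `t` disjoint copies of `G_q`: all roots become one vertex and, for
every `j ∈ [m_q]`, the last-level vertices `φ⁻¹ (π_i j)` of the copies `i` become one vertex. -/
inductive Glue {t : ℕ} (ht : 2 ≤ t) (k q : ℕ) (π : Fin t → Equiv.Perm (Fin (levelSize t k q))) :
    Fin t × TreeVertex t k q → Fin t × TreeVertex t k q → Prop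
  | root (i i' : Fin t) : Glue ht k q π (i, treeRoot t k q) (i', treeRoot t k q)
  | leaf (i i' : Fin t) (j : Fin (levelSize t k q)) :
      Glue ht k q π (i, ((levelOrder ht k q).symm (π i j)).toVertex)
        (i', ((levelOrder ht k q).symm (π i' j)).toVertex)

/-- The graph `G(t, k, q, Π)`: glue `t` copies of `G_q` at their roots and, through the permutations
`Π`, at their last levels. -/
def gluedGraph {t : ℕ} (ht : 2 ≤ t) (k q : ℕ) (π : Fin t → Equiv.Perm (Fin (levelSize t k q))) :
    SimpleGraph (Quot (Glue ht k q π)) :=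
  identify (copies t (treeGraph t k q)) (Glue ht k q π)

end TreeGluing

/-! View the glued graph as points and blocks, a block being a copy of $K_k$ inside one tree. For
$q\ge 1$ and any permutations, every block has $k$ points and every point lies in $t$ blocks
(`card_blockInc_left`, `card_blockInc_right`), and the graph is connected. If moreover no reduced
chain of blocks of length at most $L$ closes up, where $L\ge 3$, then the links are $tK_{k-1}$
(`GirthGT.hasConstantLink`), and a cycle of length at most $L$ stays in one block, so it has at most
$k$ vertices (`GirthGT.not_hasCycleOfLength`). Only the girth of this incidence structure has to be
arranged.

Cut each tree at a level $s>0$ with $s+L<q$, and call the leaves of tree $i$ below one vertex of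
level $s$ a cluster of colour $i$. A closed reduced chain of blocks, continued periodically, must
meet the last level, because away from it a reduced walk can only climb and then descend. Within $L$
steps it cannot climb above level $s$, so two consecutive visits are distinct leaves of one cluster,
and at each visit the walk changes trees. Hence a short closed chain of blocks yields a closed
reduced chain of clusters that is no longer (`girthGT_blockInc`).

It remains to find $t$ partitions of the leaves into clusters with large girth. `exists_clusters`
builds a small system by iterating a homology-type cover, each step of which raises the girth bound
by one (`GirthGT.lift`). Put $N=(k-1)(t-1)$. With $q=s+L+1$ each vertex of level $s$ has $N^{L+1}$
leaves below it, and the number $N^e$ of clusters of each colour divides $m_s=(k-1)N^{s-1}$ for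
large $s$, so disjoint copies of the small system fill the last level exactly
(`exists_leaf_labelling`). -/

namespace TreeGluing

/-! ### Incidence structures of large girth, and what they imply for graphs. -/

/-- A chain `v 0, b 0, v 1, b 1, …, v n` of points and blocks in which consecutive points differ
and consecutive blocks differ. -/
structure IsReducedChain {V B : Type*} (I : V → B → Prop) (n : ℕ) (v : ℕ → V) (b : ℕ → B) :
    Prop where
  left : ∀ m < n, I (v m) (b m)
  right : ∀ m < n, I (v (m + 1)) (b m)
  ne : ∀ m < n, v m ≠ v (m + 1)
  block_ne : ∀ m, m + 1 < n → b m ≠ b (m + 1)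

/-- No reduced chain of positive length at most `L` is closed. -/
def GirthGT {V B : Type*} (I : V → B → Prop) (L : ℕ) : Prop :=
  ∀ n v b, 0 < n → n ≤ L → IsReducedChain I n v b → v 0 ≠ v n

section Incidence

variable {V B : Type*} {I : V → B → Prop} {L : ℕ}

theorem IsReducedChain.sub {n : ℕ} {v : ℕ → V} {b : ℕ → B} (h : IsReducedChain I n v b)
    (a l : ℕ) (hal : a + l ≤ n) :
    IsReducedChain I l (fun m => v (a + m)) (fun m => b (a + m)) where
  left m hm := h.left _ (by omega)
  right m hm := h.right (a + m) (by omega)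
  ne m hm := h.ne (a + m) (by omega)
  block_ne m hm := h.block_ne (a + m) (by omega)

theorem GirthGT.ne_of_lt (hI : GirthGT I L) {n : ℕ} {v : ℕ → V} {b : ℕ → B}
    (h : IsReducedChain I n v b) {a c : ℕ} (hac : a < c) (hcn : c ≤ n) (hL : c ≤ a + L) :
    v a ≠ v c := by
  have := hI (c - a) _ _ (by omega) (by omega) (h.sub a (c - a) (by omega))
  simpa [show a + (c - a) = c by omega] using this

/-- The girth bound pulls back along locally injective maps. -/
theorem GirthGT.comap {V' B' : Type*} {I' : V' → B' → Prop} (hI : GirthGT I L)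
    (f : V' → V) (g : B' → B) (hfg : ∀ x b, I' x b → I (f x) (g b))
    (hf : ∀ x y b, I' x b → I' y b → x ≠ y → f x ≠ f y)
    (hg : ∀ x b c, I' x b → I' x c → b ≠ c → g b ≠ g c) : GirthGT I' L := by
  intro n v b hn hnL h h0
  refine hI n (f ∘ v) (g ∘ b) hn hnL ⟨fun m hm => hfg _ _ (h.left m hm),
    fun m hm => hfg _ _ (h.right m hm),
    fun m hm => hf _ _ _ (h.left m hm) (h.right m hm) (h.ne m hm),
    fun m hm => hg _ _ _ (h.right m (by omega)) (h.left _ hm) (h.block_ne m hm)⟩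
    (congrArg f h0)

theorem IsReducedChain.snoc {n : ℕ} {v : ℕ → V} {b : ℕ → B} (h : IsReducedChain I n v b)
    {y : V} {c : B} (h1 : I (v n) c) (h2 : I y c) (hy : v n ≠ y)
    (hc : ∀ m, m + 1 = n → b m ≠ c) :
    IsReducedChain I (n + 1) (fun m => if m ≤ n then v m else y)
      (fun m => if m < n then b m else c) where
  left m hm := by
    rcases Nat.lt_succ_iff_lt_or_eq.mp hm with h' | rfl
    · simpa [h', h'.le] using h.left m h'
    · simpa using h1
  right m hm := by
    rcases Nat.lt_succ_iff_lt_or_eq.mp hm with h' | rfl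
    · simpa [h', Nat.succ_le_of_lt h'] using h.right m h'
    · simpa using h2
  ne m hm := by
    rcases Nat.lt_succ_iff_lt_or_eq.mp hm with h' | rfl
    · simpa [h', h'.le, Nat.succ_le_of_lt h'] using h.ne m h'
    · simpa using hy
  block_ne m hm := by
    rcases Nat.lt_succ_iff_lt_or_eq.mp hm with h' | h'
    · simpa [show m < n by omega, show m + 1 < n by omega] using h.block_ne m (by omega)
    · simpa [show m < n by omega, show ¬ m + 1 < n by omega] using hc m (by omega)

/-- A shortest closed reduced chain can be continued periodically. -/
theorem girthGT_of_periodic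
    (H : ∀ n v b, 0 < n → n ≤ L → (∀ l, IsReducedChain I l v b) → ¬ ∀ m, v (m + n) = v m) :
    GirthGT I L := by
  intro n
  induction n using Nat.strong_induction_on with
  | _ n ih =>
  intro v b hn hnL h h0
  have hn1 : n ≠ 1 := by
    rintro rfl
    exact h.ne 0 one_pos h0
  -- Reducedness is not cyclic, so the first and last block may agree. Then the two end steps either
  -- cancel or merge into one step from `v (n - 1)` to `v 1` inside that block, and the chain
  -- shortens.
  by_cases hb : b (n - 1) = b 0
  · have hn2 : n ≠ 2 := by
      rintro rfl
      exact h.block_ne 0 (by norm_num) hb.symm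
    by_cases hv : v 1 = v (n - 1)
    · refine ih (n - 2) (by omega) _ _ (by omega) (by omega) (h.sub 1 (n - 2) (by omega)) ?_
      simpa [show 1 + (n - 2) = n - 1 by omega] using hv
    · have h1 := (h.sub 1 (n - 2) (by omega)).snoc (y := v 1) (c := b (n - 1))
        (by simpa [show 1 + (n - 2) = n - 1 by omega] using h.left (n - 1) (by omega))
        (by rw [hb]; exact h.right 0 hn)
        (by simpa [show 1 + (n - 2) = n - 1 by omega] using Ne.symm hv)
        (by
          intro m hm
          have := h.block_ne (1 + m) (by omega)
          rwa [show 1 + m + 1 = n - 1 by omega] at this)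
      exact ih (n - 2 + 1) (by omega) _ _ (by omega) (by omega) h1 (by simp)
  · refine H n (fun m => v (m % n)) (fun m => b (m % n)) hn hnL (fun l => ?_)
      (fun m => by simp)
    have key : ∀ m, v ((m + 1) % n) = v (m % n + 1) := by
      intro m
      have hm := Nat.mod_lt m hn
      rw [Nat.add_mod, Nat.mod_eq_of_lt (show 1 < n by omega)]
      rcases Nat.lt_or_ge (m % n + 1) n with h' | h'
      · rw [Nat.mod_eq_of_lt h']
      · have : m % n + 1 = n := by omega
        rw [this, Nat.mod_self, h0]
    refine ⟨fun m _ => h.left _ (Nat.mod_lt m hn), fun m _ => ?_, fun m _ => ?_, fun m _ => ?_⟩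
    · rw [key]; exact h.right _ (Nat.mod_lt m hn)
    · rw [key]; exact h.ne _ (Nat.mod_lt m hn)
    · have hm := Nat.mod_lt m hn
      rw [Nat.add_mod, Nat.mod_eq_of_lt (show 1 < n by omega)]
      rcases Nat.lt_or_ge (m % n + 1) n with h' | h'
      · rw [Nat.mod_eq_of_lt h']; exact h.block_ne _ h'
      · have h'' : m % n + 1 = n := by omega
        rw [h'', Nat.mod_self, show m % n = n - 1 by omega]
        exact hb

/-- A short closed chain of blocks with distinct points uses a single block. -/
theorem GirthGT.block_eq (hI : GirthGT I L) (n : ℕ) (v : ℕ → V) (b : ℕ → B) (hnL : n ≤ L)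
    (hl : ∀ m < n, I (v m) (b m)) (hr : ∀ m < n, I (v (m + 1)) (b m)) (h0 : v 0 = v n)
    (hinj : ∀ i < n, ∀ j < n, v i = v j → i = j) : ∀ m < n, b m = b 0 := by
  induction n generalizing v b with
  | zero => intro m hm; omega
  | succ n ih =>
    -- A repeated consecutive block allows deleting the point `v (j + 1)` between the two
    -- occurrences. Without repetitions the chain is reduced, which the girth forbids unless it has
    -- length one.
    by_cases hred : ∃ j, j < n ∧ b j = b (j + 1)
    · obtain ⟨j, hj, hbj⟩ := hred
      have := ih (fun i => if i ≤ j then v i else v (i + 1))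
        (fun i => if i ≤ j then b i else b (i + 1)) (by omega)
        (fun m hm => by
          split_ifs with h
          · exact hl m (by omega)
          · exact hl _ (by omega))
        (fun m hm => by
          split_ifs with h h' h'
          · exact hr m (by omega)
          · omega
          · rw [show m = j by omega, hbj]; exact hr _ (by omega)
          · exact hr _ (by omega))
        (by simpa [show ¬ n ≤ j by omega] using h0)
        (fun i hi l hl' => by
          split_ifs with h h' h' <;> intro he
          · exact hinj i (by omega) l (by omega) he
          · have := hinj _ (by omega) _ (by omega) he; omega
          · have := hinj _ (by omega) _ (by omega) he; omega
          · have := hinj _ (by omega) _ (by omega) he; omega)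
      simp only [zero_le, if_true] at this
      intro m hm
      rcases lt_trichotomy m (j + 1) with h | h | h
      · simpa [show m ≤ j by omega] using this m (by omega)
      · rw [h, ← hbj]; simpa using this j hj
      · have h2 := this (m - 1) (by omega)
        rwa [if_neg (by omega), show m - 1 + 1 = m by omega] at h2
    · push Not at hred
      rcases Nat.eq_zero_or_pos n with rfl | hn
      · intro m hm; rw [show m = 0 by omega]
      · refine absurd h0 (hI (n + 1) v b (by omega) hnL ⟨hl, hr, fun m hm he => ?_,
          fun m hm => hred m (by omega)⟩)
        rcases Nat.lt_or_ge (m + 1) (n + 1) with h | h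
        · have := hinj _ hm _ h he; omega
        · rw [show m + 1 = n + 1 by omega, ← h0] at he
          have := hinj _ hm _ (by omega) he; omega

/-- Otherwise `x, b, y, c, x` would be a closed chain of length 2 with two different blocks. -/
theorem GirthGT.block_unique (hI : GirthGT I L) (hL : 2 ≤ L) {x y : V} {b c : B} (hxy : x ≠ y)
    (hxb : I x b) (hyb : I y b) (hxc : I x c) (hyc : I y c) : b = c := by
  have := hI.block_eq 2 (fun m => if m = 1 then y else x) (fun m => if m = 0 then b else c) hL
    (by intro m hm; interval_cases m <;> simp [*])
    (by intro m hm; interval_cases m <;> simp [*]) rfl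
    (by intro i hi j hj; interval_cases i <;> interval_cases j <;> simp [hxy, hxy.symm]) 1
    (by norm_num)
  simpa using this.symm

/-- The case of length 3 of `GirthGT.block_eq`. It shows that adjacent neighbours of a vertex share
its block, so that different blocks contribute disjoint, non-adjacent cliques to the link. -/
theorem GirthGT.triangle (hI : GirthGT I L) (hL : 3 ≤ L) {x y z : V} {b c d : B} (hxy : x ≠ y)
    (hyz : y ≠ z) (hxz : x ≠ z)
    (hxb : I x b) (hyb : I y b) (hyc : I y c) (hzc : I z c) (hzd : I z d) (hxd : I x d) :
    b = d := by
  have := hI.block_eq 3 (fun m => if m = 1 then y else if m = 2 then z else x)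
    (fun m => if m = 0 then b else if m = 1 then c else d) hL
    (by intro m hm; interval_cases m <;> simp [*])
    (by intro m hm; interval_cases m <;> simp [*]) rfl
    (by
      intro i hi j hj
      interval_cases i <;> interval_cases j <;> simp [hxy, hxy.symm, hyz, hyz.symm, hxz, hxz.symm])
    2 (by norm_num)
  simpa using this.symm

/-- If adjacency is membership in a common block, and blocks have `k` points, then a short cycle
lies in a block. -/
theorem GirthGT.not_hasCycleOfLength (hI : GirthGT I L) {G : SimpleGraph V}
    (hG : ∀ x y, G.Adj x y → ∃ b, I x b ∧ I y b) {k : ℕ} (hk : 0 < k)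
    (hB : ∀ b, Nat.card {x // I x b} = k) {h : ℕ} (hkh : k < h) (hhL : h ≤ L) :
    ¬ HasCycleOfLength G h := by
  rintro ⟨x, c, hc, hlen⟩
  have : Nonempty B := by
    have h0 : 0 < c.length := by omega
    exact (hG _ _ (c.adj_getVert_succ h0)).nonempty
  choose! b hb1 hb2 using fun m (hm : m < c.length) => hG _ _ (c.adj_getVert_succ hm)
  subst hlen
  have hinj : ∀ i < c.length, ∀ j < c.length, c.getVert i = c.getVert j → i = j :=
    fun i hi j hj he => hc.getVert_injOn' (by simp; omega) (by simp; omega) he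
  have hall := hI.block_eq c.length c.getVert b hhL hb1 hb2 (by simp) hinj
  have : Finite {x // I x (b 0)} := Nat.finite_of_card_ne_zero (by rw [hB]; omega)
  have hle := Nat.card_le_card_of_injective
    (fun m : Fin c.length => (⟨c.getVert m, hall m m.2 ▸ hb1 m m.2⟩ : {x // I x (b 0)}))
    (fun m m' hm => Fin.ext (hinj _ m.2 _ m'.2 (congrArg Subtype.val hm)))
  rw [hB, Nat.card_eq_fintype_card, Fintype.card_fin] at hle
  omega

/-- If adjacency is membership in a common block, every point is in `t` blocks and every block has
`k` points, then the link is constant. -/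
theorem GirthGT.hasConstantLink (hI : GirthGT I L) (hL : 3 ≤ L) {G : SimpleGraph V}
    (hG : ∀ x y, G.Adj x y ↔ x ≠ y ∧ ∃ b, I x b ∧ I y b) {k t : ℕ} (hk : 2 ≤ k) (ht : 0 < t)
    (hV : ∀ x, Nat.card {b // I x b} = t) (hB : ∀ b, Nat.card {x // I x b} = k) :
    HasConstantLink G (copies t (⊤ : SimpleGraph (Fin (k - 1)))) := by
  intro x
  have hfin : Finite {b // I x b} := Nat.finite_of_card_ne_zero (by rw [hV]; omega)
  let e : {b // I x b} ≃ Fin t := Finite.equivFinOfCardEq (hV x)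
  have hcard : ∀ b : {b // I x b}, Nat.card {y // y ≠ x ∧ I y b.1} = k - 1 := by
    intro b
    have hfin' : Finite {y // I y b.1} := Nat.finite_of_card_ne_zero (by rw [hB]; omega)
    have h1 : Nat.card {y // y ≠ x ∧ I y b.1} = ({y | I y b.1} \ {x}).ncard := by
      rw [← Nat.card_coe_set_eq]
      refine Nat.card_congr (Equiv.subtypeEquivRight fun y => ?_)
      simp [and_comm]
    have h2 : ({y | I y b.1}).ncard = k := by rw [← hB b.1, ← Nat.card_coe_set_eq]; rfl
    have := Set.ncard_sdiff_singleton_add_one (s := {y | I y b.1}) (a := x) b.2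
      (Set.finite_coe_iff.mp hfin')
    omega
  have hfin2 : ∀ b : {b // I x b}, Finite {y // y ≠ x ∧ I y b.1} := fun b =>
    Nat.finite_of_card_ne_zero (by rw [hcard]; omega)
  let f : ∀ b : {b // I x b}, {y // y ≠ x ∧ I y b.1} ≃ Fin (k - 1) := fun b =>
    Finite.equivFinOfCardEq (hcard b)
  choose bl hbl using fun y : G.neighborSet x => ((hG x y.1).mp y.2).2
  have hne : ∀ y : G.neighborSet x, y.1 ≠ x := fun y => ((hG x y.1).mp y.2).1.symm
  -- A neighbour is sent to the block it shares with `x`, unique by `block_unique`, and to its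
  -- position among the other $k-1$ points of that block.
  let φ : G.neighborSet x ≃ Fin t × Fin (k - 1) :=
    { toFun := fun y => (e ⟨bl y, (hbl y).1⟩, f ⟨bl y, (hbl y).1⟩ ⟨y.1, hne y, (hbl y).2⟩)
      invFun := fun z => ⟨((f (e.symm z.1)).symm z.2).1, (hG _ _).mpr
        ⟨((f (e.symm z.1)).symm z.2).2.1.symm, _, (e.symm z.1).2,
          ((f (e.symm z.1)).symm z.2).2.2⟩⟩
      left_inv := by
        intro y
        apply Subtype.ext
        dsimp only
        have : e.symm (e ⟨bl y, (hbl y).1⟩) = ⟨bl y, (hbl y).1⟩ := by simp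
        rw [this]
        simp
      right_inv := by
        rintro ⟨i, j⟩
        obtain ⟨b, rfl⟩ := e.surjective i
        obtain ⟨y, rfl⟩ := (f b).surjective j
        have he : e.symm (e b) = b := by simp
        have key : ∀ (b' : {b // I x b}) (hb' : b' = b) (h : y.1 ≠ x ∧ I y.1 b'.1),
            (e b', f b' ⟨y.1, h⟩) = (e b, f b y) := by
          rintro _ rfl h
          rfl
        have hy : ((f (e.symm (e b))).symm (f b y)).1 = y.1 := by
          rw [he]; simp
        have hmem : G.Adj x y.1 := (hG _ _).mpr ⟨y.2.1.symm, _, b.2, y.2.2⟩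
        have h2 : ∀ z : G.neighborSet x, z = ⟨y.1, hmem⟩ →
            (e ⟨bl z, (hbl z).1⟩, f ⟨bl z, (hbl z).1⟩ ⟨z.1, hne z, (hbl z).2⟩) = (e b, f b y) := by
          rintro _ rfl
          refine key _ (Subtype.ext ?_) _
          exact hI.block_unique (by omega) y.2.1.symm (hbl ⟨y.1, hmem⟩).1
            (hbl ⟨y.1, hmem⟩).2 b.2 y.2.2
        exact h2 _ (Subtype.ext hy) }
  refine ⟨⟨φ, ?_⟩⟩
  intro y z
  simp only [copies, SimpleGraph.comap_adj, SimpleGraph.top_adj, Function.Embedding.subtype_apply]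
  have hφ : ∀ y, (φ y).1 = e ⟨bl y, (hbl y).1⟩ := fun y => rfl
  constructor
  · rintro ⟨h1, h2⟩
    have hyz : y ≠ z := by rintro rfl; exact h2 rfl
    rw [hφ, hφ] at h1
    have h3 : bl y = bl z := congrArg Subtype.val (e.injective h1)
    exact (hG _ _).mpr ⟨fun h => hyz (Subtype.ext h), bl y, (hbl y).2, h3 ▸ (hbl z).2⟩
  · intro h
    obtain ⟨hyz, c, hc1, hc2⟩ := (hG _ _).mp h
    have h3 : bl y = bl z := hI.triangle hL (hne y).symm hyz (hne z).symm (hbl y).1 (hbl y).2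
      hc1 hc2 (hbl z).2 (hbl z).1
    have h1 : (φ y).1 = (φ z).1 := by
      rw [hφ, hφ]; exact congrArg e (Subtype.ext h3)
    refine ⟨h1, fun h2 => hyz ?_⟩
    exact congrArg Subtype.val (φ.injective (Prod.ext h1 h2))

end Incidence

/-! ### Cluster systems of large girth. -/

/-- Points and coloured clusters: `p` lies in the cluster `c i p` of colour `i`. -/
def ClusterInc {ι P K : Type*} (c : ι → P → K) (p : P) (b : ι × K) : Prop := c b.1 p = b.2

/-- One step of the homology cover raises the girth. -/
theorem GirthGT.lift {ι P K : Type*} [DecidableEq ι] [DecidableEq P] {R : Type*} [AddCommGroup R]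
    {r : R} (hr : r ≠ 0) {c : ι → P → K} {L : ℕ} (h : GirthGT (ClusterInc c) L) :
    GirthGT (ClusterInc (P := P × (P × ι → R)) (K := K × (P × ι → R))
      fun i x => (c i x.1, x.2 + Pi.single (x.1, i) r)) (L + 1) := by
  intro n v b hn hnL hv h0
  have hchain : IsReducedChain (ClusterInc c) n (fun m => (v m).1)
      (fun m => ((b m).1, (b m).2.1)) := by
    refine ⟨fun m hm => congrArg Prod.fst (hv.left m hm),
      fun m hm => congrArg Prod.fst (hv.right m hm), fun m hm he => ?_, fun m hm he => ?_⟩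
    · have h1 := congrArg Prod.snd ((hv.left m hm).trans (hv.right m hm).symm)
      dsimp only at h1 he
      rw [he] at h1
      exact hv.ne m hm (Prod.ext he (add_right_cancel h1))
    · apply hv.block_ne m hm
      have h1 := congrArg Prod.fst he
      refine Prod.ext h1 ?_
      rw [← hv.right m (by omega), ← hv.left (m + 1) hm]
      dsimp only at h1 ⊢
      rw [h1]
  have hdist : ∀ a c, a < c → c ≤ n → c ≤ a + L → (v a).1 ≠ (v c).1 := fun a c h1 h2 h3 =>
    h.ne_of_lt hchain h1 h2 h3
  -- The second component records the walk: a step in colour `i` from `p` to `p'` adds `r` at `(p,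
  -- i)` and subtracts `r` at `(p', i)`.
  have hstep : ∀ m < n, (v (m + 1)).2 - (v m).2 =
      Pi.single ((v m).1, (b m).1) r - Pi.single ((v (m + 1)).1, (b m).1) r := by
    intro m hm
    have h1 := congrArg Prod.snd ((hv.left m hm).trans (hv.right m hm).symm)
    dsimp only at h1
    rw [sub_eq_sub_iff_add_eq_add, ← h1, add_comm]
  -- Follow the coordinate at which the first step arrives. Closing up makes its total change zero,
  -- but step 0 contributes `-r`. No later step touches it: by the girth bound `L` below, the
  -- projected walk does not return to `(v 1).1` within the remaining at most `L` steps, and step 1,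
  -- which leaves that point, has another colour.
  have hsum := Finset.sum_range_sub (fun m => (v m).2 ((v 1).1, (b 0).1)) n
  rw [← h0, sub_self, Finset.sum_eq_single 0] at hsum
  · have h1 := congrFun (hstep 0 hn) ((v 1).1, (b 0).1)
    have h2 : ((v 1).1, (b 0).1) ≠ ((v 0).1, (b 0).1) := fun he =>
      hchain.ne 0 hn (congrArg Prod.fst he).symm
    simp only [Pi.sub_apply, zero_add, Pi.single_eq_same, Pi.single_eq_of_ne h2] at h1
    rw [zero_add, h1] at hsum
    simp [hr] at hsum
  · intro m hm hm0
    rw [Finset.mem_range] at hm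
    have h1 := congrFun (hstep m hm) ((v 1).1, (b 0).1)
    have h2 : ((v 1).1, (b 0).1) ≠ ((v (m + 1)).1, (b m).1) := fun he =>
      hdist 1 (m + 1) (by omega) hm (by omega) (Prod.mk.inj he).1
    have h3 : ((v 1).1, (b 0).1) ≠ ((v m).1, (b m).1) := fun he => by
      rcases Nat.lt_or_ge 1 m with h' | h'
      · exact hdist 1 m h' hm.le (by omega) (Prod.mk.inj he).1
      · obtain rfl : m = 1 := by omega
        have he2 := congrArg Prod.snd he
        dsimp only at he2
        apply hchain.block_ne 0 hm
        refine Prod.ext he2 ?_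
        have e1 := hchain.right 0 hn
        have e2 := hchain.left 1 hm
        simp only [ClusterInc] at e1 e2
        dsimp only at e1 e2 ⊢
        rw [← e1, ← e2, he2]
    simpa [Pi.single_eq_of_ne h2, Pi.single_eq_of_ne h3] using h1
  · simp; omega

/-- Cluster systems with clusters of size `C`, a power of `N` many clusters of each colour, and
large girth. -/
theorem exists_clusters (ι : Type) [Finite ι] (C : ℕ) {N : ℕ} (hN : 2 ≤ N) (L : ℕ) :
    ∃ (P K : Type) (c : ι → P → K) (e : ℕ), Finite P ∧ Finite K ∧ Nat.card K = N ^ e ∧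
      (∀ i x, Nat.card {p // c i p = x} = C) ∧ GirthGT (ClusterInc c) L := by
  classical
  have : Fact (1 < N) := ⟨hN⟩
  have : NeZero N := ⟨by omega⟩
  induction L with
  | zero =>
    -- The girth bound 0 is vacuous, so a single cluster of size `C` in each colour suffices.
    refine ⟨Fin C, Unit, fun _ _ => (), 0, inferInstance, inferInstance, by simp, ?_, ?_⟩
    · intro i x
      simp
    · intro n v b hn hnL
      omega
  | succ L ih =>
    obtain ⟨P, K, c, e, hP, hK, hcard, hfib, hg⟩ := ih
    -- Coefficients in `ZMod N` keep the number of clusters a power of `N`. Cluster sizes do not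
    -- change, because inside a given cluster the function is determined by the point of `P`.
    refine ⟨P × (P × ι → ZMod N), K × (P × ι → ZMod N),
      fun i x => (c i x.1, x.2 + Pi.single (x.1, i) 1), e + Nat.card (P × ι), inferInstance,
      inferInstance, ?_, ?_, hg.lift one_ne_zero⟩
    · have := Fintype.ofFinite (P × ι)
      rw [Nat.card_prod, hcard, Nat.card_fun, Nat.card_zmod, pow_add]
    · rintro i ⟨x, f⟩
      rw [← hfib i x]
      refine Nat.card_congr
        { toFun := fun p => ⟨p.1.1, congrArg Prod.fst p.2⟩
          invFun := fun p => ⟨(p.1, f - Pi.single (p.1, i) 1), by simp [p.2]⟩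
          left_inv := ?_
          right_inv := fun p => rfl }
      rintro ⟨⟨p, f'⟩, h⟩
      obtain ⟨rfl, rfl⟩ := Prod.mk.inj h
      simp

/-! ### Transporting a cluster system to the last level. -/

/-- A label of length `s + r` with `s > 0` is a label of length `s` followed by `r` columns. -/
def levelAddEquiv (t k : ℕ) {s : ℕ} (hs : 0 < s) (r : ℕ) :
    Level t k (s + r) ≃ Level t k s × List.Vector (Column t k) r where
  toFun w := (⟨w.1.take s, fun c hc => w.2.1 c (by
      rw [List.head?_take, if_neg (by omega)] at hc; exact hc), by simp [w.2.2]⟩,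
    ⟨w.1.drop s, by simp [w.2.2]⟩)
  invFun x := ⟨x.1.1 ++ x.2.1, fun c hc => x.1.2.1 c (by
      rw [List.head?_append_of_ne_nil _
        (List.ne_nil_of_length_pos (by rw [x.1.2.2]; exact hs))] at hc
      exact hc), by simp [x.1.2.2, x.2.2]⟩
  left_inv w := Subtype.ext (List.take_append_drop s w.1)
  right_inv := by
    rintro ⟨⟨w, hw, hl⟩, ⟨l, hl'⟩⟩
    subst hl
    simp

theorem card_vector_column (t k r : ℕ) :
    Finite (List.Vector (Column t k) r) ∧
      Nat.card (List.Vector (Column t k) r) = ((k - 1) * (t - 1)) ^ r := by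
  have : Fintype (Column t k) := inferInstanceAs (Fintype (Fin (t - 1) × Fin (k - 1)))
  have hc : Fintype.card (Column t k) = (t - 1) * (k - 1) := by
    rw [← Nat.card_eq_fintype_card]
    exact (Nat.card_congr ofLex).trans (by simp)
  refine ⟨inferInstance, ?_⟩
  rw [Nat.card_eq_fintype_card, card_vector, hc, mul_comm]

/-- Labellings of one set by the last levels of `t` trees for which the subtrees hanging below
level `s` form a cluster system of large girth. -/
theorem exists_leaf_labelling {t k : ℕ} (ht : 2 < t) (hk : 2 ≤ k) (L : ℕ) :
    ∃ q₀ : ℕ, ∀ q, q₀ ≤ q → ∃ s, 0 < s ∧ s + L < q ∧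
      ∃ β : Fin t → Fin (levelSize t k q) ≃ Level t k q,
        GirthGT (ClusterInc fun i j => (β i j).1.take s) L := by
  have hN : 2 ≤ (k - 1) * (t - 1) :=
    le_trans (show 2 ≤ 1 * 2 by norm_num) (Nat.mul_le_mul (by omega) (by omega))
  obtain ⟨P, K, c, e, hP, hK, hcard, hfib, hg⟩ :=
    exists_clusters (Fin t) (((k - 1) * (t - 1)) ^ (L + 1)) hN L
  -- The cut is at level `s = d + e + 1`, leaving `L + 1` levels below it. Level `s` has
  -- $(k-1)N^{d+e}$ vertices, which is $N^e$ times the size of `D` below; the slack `d` absorbs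
  -- every larger `q`.
  refine ⟨e + 1 + (L + 1), fun q hq => ?_⟩
  obtain ⟨d, rfl⟩ : ∃ d, q = (d + e + 1) + (L + 1) := ⟨q - (e + 1 + (L + 1)), by omega⟩
  refine ⟨d + e + 1, by omega, by omega, ?_⟩
  obtain ⟨hfs, hcs⟩ := level_finite_card ht.le k (d + e + 1)
  obtain ⟨hfv, hcv⟩ := card_vector_column t k (L + 1)
  let D := Fin ((k - 1) * ((k - 1) * (t - 1)) ^ d)
  have hKD : Nat.card (K × D) = Nat.card (Level t k (d + e + 1)) := by
    rw [hcs, Nat.card_prod, hcard, Nat.card_eq_fintype_card, Fintype.card_fin, levelSize,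
      Nat.add_sub_cancel, pow_succ, pow_add, pow_add, mul_pow, mul_pow]
    ring
  have εK : K × D ≃ Level t k (d + e + 1) := (Finite.card_eq.mp hKD).some
  let εF : ∀ i x, {p // c i p = x} ≃ List.Vector (Column t k) (L + 1) := fun i x =>
    (Finite.card_eq.mp (by rw [hfib, hcv])).some
  let δ : Fin t → P ≃ K × List.Vector (Column t k) (L + 1) := fun i =>
    ((Equiv.sigmaFiberEquiv (c i)).symm.trans (Equiv.sigmaCongrRight (εF i))).trans
      (Equiv.sigmaEquivProd K _)
  let γ : Fin t → P × D ≃ Level t k (d + e + 1 + (L + 1)) := fun i =>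
    (((δ i).prodCongr (Equiv.refl D)).trans 
      ⟨fun x => ((x.1.1, x.2), x.1.2), fun x => ((x.1.1, x.2), x.1.2), fun _ => rfl, fun _ => rfl⟩).trans
      ((εK.prodCongr (Equiv.refl _)).trans (levelAddEquiv t k (by omega) (L + 1)).symm)
  have hγ : ∀ i x, ((γ i x).1.take (d + e + 1)) = (εK (c i x.1, x.2)).1 := fun i x =>
    congrArg (fun z => z.1.1)
      ((levelAddEquiv t k (s := d + e + 1) (by omega) (L + 1)).apply_symm_apply
        (εK (c i x.1, x.2), εF i (c i x.1) ⟨x.1, rfl⟩))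
  -- Any bijection would do here; only the fibres of the maps `γ i` over level `s` matter.
  let α : Fin (levelSize t k (d + e + 1 + (L + 1))) ≃ P × D :=
    (levelOrder ht.le k _).symm.toEquiv.trans (γ ⟨0, by omega⟩).symm
  refine ⟨fun i => α.trans (γ i), ?_⟩
  have hm : 0 < levelSize t k (d + e + 1 + (L + 1)) :=
    Nat.mul_pos (pow_pos (by omega) _) (pow_pos (by omega) _)
  have : Nonempty (K × D) := ⟨(c ⟨0, by omega⟩ (α ⟨0, hm⟩).1, (α ⟨0, hm⟩).2)⟩
  -- `κ` recovers the cluster and its copy from a word of level `s`; its values on other words are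
  -- irrelevant.
  obtain ⟨κ, hκ⟩ : Function.HasLeftInverse (fun x => (εK x).1) :=
    Function.Injective.hasLeftInverse fun x y h => εK.injective (Subtype.ext h)
  -- Forgetting the copy index in `D` is injective on each cluster, since all points of a cluster
  -- lie in the same copy.
  refine hg.comap (fun j => (α j).1) (fun b => (b.1, (κ b.2).1)) ?_ ?_ ?_
  · rintro j ⟨i, l⟩ h
    have h1 : (γ i (α j)).1.take (d + e + 1) = l := h
    rw [hγ] at h1
    change c i (α j).1 = (κ l).1
    rw [← h1]
    exact (congrArg Prod.fst (hκ (c i (α j).1, (α j).2))).symm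
  · rintro j j' ⟨i, l⟩ h h' hne he
    have h1 : (γ i (α j)).1.take (d + e + 1) = (γ i (α j')).1.take (d + e + 1) := h.trans h'.symm
    rw [hγ, hγ] at h1
    have h2 := congrArg Prod.snd (εK.injective (Subtype.ext h1))
    exact hne (α.injective (Prod.ext he h2))
  · rintro j ⟨i, l⟩ ⟨i', l'⟩ h h' hne he
    obtain rfl : i = i' := congrArg Prod.fst he
    exact hne (Prod.ext rfl (h.symm.trans h'))

/-! ### Blocks of the glued graph, their incidence numbers, and connectedness. -/

/-- The block of `G(t, k, q, Π)` in the tree `tree` that consists of `top` and of the vertices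
of the `idx`-th copy of `K_{k-1}` attached to it. -/
@[ext]
structure Block (t k q : ℕ) where
  tree : Fin t
  top : List (Column t k)
  idx : Fin (t - 1)
  isLabel : IsLabel top
  length_lt : top.length < q
  idx_eq_zero : top = [] → (idx : ℕ) = 0

section Blocks

variable {t k q : ℕ}

/-- `w` is a vertex of the copy of `K_{k-1}` in the block. -/
def Block.IsChild (b : Block t k q) (w : List (Column t k)) : Prop :=
  ∃ v, w = b.top ++ [toLex (b.idx, v)]

theorem Block.IsChild.length {b : Block t k q} {w : List (Column t k)} (h : b.IsChild w) :
    w.length = b.top.length + 1 := by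
  obtain ⟨v, rfl⟩ := h
  simp

theorem Block.IsChild.top_prefix {b : Block t k q} {w : List (Column t k)} (h : b.IsChild w) :
    b.top <+: w := by
  obtain ⟨v, rfl⟩ := h
  exact List.prefix_append _ _

theorem Block.IsChild.eq {b c : Block t k q} {w : List (Column t k)} (hb : b.IsChild w)
    (hc : c.IsChild w) (h : b.tree = c.tree) : b = c := by
  obtain ⟨v, rfl⟩ := hb
  obtain ⟨v', h'⟩ := hc
  obtain ⟨h1, h2⟩ := List.append_inj' h' rfl
  simp only [List.cons.injEq, toLex_inj, Prod.mk.injEq, and_true] at h2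
  exact Block.ext h h1 h2.1

theorem isLabel_append {p : List (Column t k)} (hp : IsLabel p) {u : Fin (t - 1)}
    (hu : p = [] → (u : ℕ) = 0) (v : Fin (k - 1)) : IsLabel (p ++ [toLex (u, v)]) := by
  intro c hc
  cases p with
  | nil =>
    simp only [List.nil_append, List.head?_cons, Option.mem_def, Option.some.injEq] at hc
    subst hc
    exact hu rfl
  | cons d p => exact hp c hc

theorem isLabel_of_append {p : List (Column t k)} {u : Fin (t - 1)} {v : Fin (k - 1)}
    (h : IsLabel (p ++ [toLex (u, v)])) : IsLabel p ∧ (p = [] → (u : ℕ) = 0) := by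
  cases p with
  | nil => exact ⟨by simp [IsLabel], fun _ => h (toLex (u, v)) rfl⟩
  | cons d p => exact ⟨fun c hc => h c hc, fun h => by simp at h⟩

/-- Every vertex but the root is a child in exactly one block of its tree. -/
theorem exists_isChild (i : Fin t) (a : TreeVertex t k q) (ha : a.1 ≠ []) :
    ∃ b : Block t k q, b.tree = i ∧ b.IsChild a.1 := by
  obtain ⟨w, hw, hq⟩ := a
  obtain ⟨p, c, rfl⟩ : ∃ p c, w = p ++ [c] :=
    ⟨_, _, (List.dropLast_append_getLast ha).symm⟩
  obtain ⟨u, v⟩ := c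
  have := isLabel_of_append hw
  exact ⟨⟨i, p, u, this.1, by rw [List.length_append] at hq; exact hq, this.2⟩, rfl, v, rfl⟩

/-- The top vertex of a block. -/
def Block.topVertex (b : Block t k q) : TreeVertex t k q := ⟨b.top, b.isLabel, b.length_lt.le⟩

/-- The `v`-th vertex of the copy of `K_{k-1}` in a block. -/
def Block.child (b : Block t k q) (v : Fin (k - 1)) : TreeVertex t k q :=
  ⟨b.top ++ [toLex (b.idx, v)], isLabel_append b.isLabel b.idx_eq_zero v, by
    simpa [Nat.succ_le_iff] using b.length_lt⟩

/-- The vertex of the last level of the `i`-th tree with number `j`. -/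
noncomputable def leafVertex (ht : 2 ≤ t) (π : Fin t → Equiv.Perm (Fin (levelSize t k q)))
    (i : Fin t) (j : Fin (levelSize t k q)) : TreeVertex t k q :=
  ((levelOrder ht k q).symm (π i j)).toVertex

variable (ht : 2 ≤ t) (π : Fin t → Equiv.Perm (Fin (levelSize t k q)))

theorem length_leafVertex (i : Fin t) (j : Fin (levelSize t k q)) :
    (leafVertex ht π i j).1.length = q := ((levelOrder ht k q).symm (π i j)).2.2

theorem leafVertex_injective (i : Fin t) : Function.Injective (leafVertex ht π i) := by
  intro j j' h
  apply (π i).injective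
  apply (levelOrder ht k q).symm.injective
  exact Subtype.ext (congrArg (fun a : TreeVertex t k q => a.1) h)

theorem exists_leafVertex (i : Fin t) (a : TreeVertex t k q) (ha : a.1.length = q) :
    ∃ j, a = leafVertex ht π i j := by
  refine ⟨(π i).symm (levelOrder ht k q ⟨a.1, a.2.1, ha⟩), ?_⟩
  exact Subtype.ext (by simp [leafVertex, Level.toVertex])

/-- A vertex of a tree, as a vertex of the glued graph. -/
def glueMk (i : Fin t) (a : TreeVertex t k q) : Quot (Glue ht k q π) := Quot.mk _ (i, a)

theorem glueMk_root (i i' : Fin t) :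
    glueMk ht π i (treeRoot t k q) = glueMk ht π i' (treeRoot t k q) :=
  Quot.sound (Glue.root i i')

theorem glueMk_leafVertex (i i' : Fin t) (j : Fin (levelSize t k q)) :
    glueMk ht π i (leafVertex ht π i j) = glueMk ht π i' (leafVertex ht π i' j) :=
  Quot.sound (Glue.leaf i i' j)

open Classical in
/-- A complete invariant of the gluing. -/
noncomputable def glueInvariant (x : Fin t × TreeVertex t k q) :
    Fin (levelSize t k q) ⊕ (Option (Fin t) × TreeVertex t k q) :=
  if h : x.2.1.length = q then
    Sum.inl ((π x.1).symm (levelOrder ht k q ⟨x.2.1, x.2.2.1, h⟩))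
  else Sum.inr (if x.2.1 = [] then none else some x.1, x.2)

theorem glueInvariant_leafVertex (i : Fin t) (j : Fin (levelSize t k q)) :
    glueInvariant ht π (i, leafVertex ht π i j) = Sum.inl j := by
  rw [glueInvariant, dif_pos (length_leafVertex ht π i j)]
  simp [leafVertex, Level.toVertex]

variable {ht π}

/-- Equality in the quotient refers to the equivalence relation generated by `Glue`. Since
`glueInvariant` is constant along `Glue` and determines the class, no identifications arise beyond
the prescribed ones; `0 < q` keeps the root apart from the leaves. -/
theorem glueMk_eq (hq : 0 < q) {i i' : Fin t} {a a' : TreeVertex t k q}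
    (h : glueMk ht π i a = glueMk ht π i' a') :
    (a = a' ∧ a.1.length < q ∧ (a.1 = [] ∨ i = i')) ∨
      ∃ j, a = leafVertex ht π i j ∧ a' = leafVertex ht π i' j := by
  have key : ∀ x y, Glue ht k q π x y → glueInvariant ht π x = glueInvariant ht π y := by
    rintro _ _ (⟨i, i'⟩ | ⟨i, i', j⟩)
    · simp [glueInvariant, treeRoot, hq.ne]
    · exact (glueInvariant_leafVertex ht π i j).trans (glueInvariant_leafVertex ht π i' j).symm
  have h1 : glueInvariant ht π (i, a) = glueInvariant ht π (i', a') :=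
    congrArg (Quot.lift (glueInvariant ht π) key) h
  by_cases ha : a.1.length = q
  · right
    obtain ⟨j, rfl⟩ := exists_leafVertex ht π i a ha
    rw [glueInvariant_leafVertex] at h1
    by_cases ha' : a'.1.length = q
    · obtain ⟨j', rfl⟩ := exists_leafVertex ht π i' a' ha'
      rw [glueInvariant_leafVertex] at h1
      obtain rfl := Sum.inl_injective h1
      exact ⟨j, rfl, rfl⟩
    · simp [glueInvariant, ha'] at h1
  · left
    by_cases ha' : a'.1.length = q
    · simp [glueInvariant, ha, ha'] at h1
    · simp only [glueInvariant, ha, ha', dite_false, Sum.inr.injEq, Prod.mk.injEq] at h1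
      obtain ⟨h2, rfl⟩ := h1
      refine ⟨rfl, lt_of_le_of_ne a.2.2 ha, ?_⟩
      by_cases h3 : a.1 = []
      · exact Or.inl h3
      · simp only [h3, if_false, Option.some.injEq] at h2
        exact Or.inr h2

theorem glueMk_injective (hq : 0 < q) (i : Fin t) : Function.Injective (glueMk ht π i) := by
  intro a a' h
  rcases glueMk_eq hq h with h | ⟨j, h1, h2⟩
  · exact h.1
  · exact h1.trans h2.symm

theorem length_eq_of_glueMk_eq (hq : 0 < q) {i i' : Fin t} {a a' : TreeVertex t k q}
    (h : glueMk ht π i a = glueMk ht π i' a') : a.1.length = a'.1.length := by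
  rcases glueMk_eq hq h with h | ⟨j, h1, h2⟩
  · rw [h.1]
  · rw [h1, h2, length_leafVertex, length_leafVertex]

variable (ht π) in
/-- Incidence of vertices and blocks of the glued graph. -/
def BlockInc (X : Quot (Glue ht k q π)) (b : Block t k q) : Prop :=
  ∃ a : TreeVertex t k q, glueMk ht π b.tree a = X ∧ (a.1 = b.top ∨ b.IsChild a.1)

/-- Reduces all graph questions to the incidence structure: the edges of a tree are exactly the
pairs of distinct vertices in one of its blocks. -/
theorem gluedGraph_adj (X Y : Quot (Glue ht k q π)) :
    (gluedGraph ht k q π).Adj X Y ↔ X ≠ Y ∧ ∃ b, BlockInc ht π X b ∧ BlockInc ht π Y b := by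
  refine and_congr_right fun hne => ⟨?_, ?_⟩
  · rintro ⟨⟨i, a⟩, ⟨i', a'⟩, ⟨hi, hadj⟩, hX, hY⟩
    obtain rfl : i = i' := hi
    have key : ∀ (a a' : TreeVertex t k q) (c : Column t k), a'.1 = a.1 ++ [c] →
        ∃ b : Block t k q, b.tree = i ∧ a.1 = b.top ∧ b.IsChild a'.1 := by
      intro a a' c h
      obtain ⟨b, hb, hch⟩ := exists_isChild i a' (by rw [h]; simp)
      obtain ⟨v, hv⟩ := id hch
      exact ⟨b, hb, (List.append_inj' (h.symm.trans hv) rfl).1, hch⟩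
    rcases hadj with ⟨c, h⟩ | ⟨c, h⟩ | ⟨p, u, v, v', hv, h, h'⟩
    · obtain ⟨b, rfl, h1, h2⟩ := key _ _ c h
      exact ⟨b, ⟨a, hX, Or.inl h1⟩, a', hY, Or.inr h2⟩
    · obtain ⟨b, rfl, h1, h2⟩ := key _ _ c h
      exact ⟨b, ⟨a, hX, Or.inr h2⟩, a', hY, Or.inl h1⟩
    · obtain ⟨b, rfl, h1⟩ := exists_isChild i a (by rw [h]; simp)
      obtain ⟨v2, hv2⟩ := id h1
      obtain ⟨h3, h4⟩ := List.append_inj' (h.symm.trans hv2) rfl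
      simp only [List.cons.injEq, toLex_inj, Prod.mk.injEq, and_true] at h4
      exact ⟨b, ⟨a, hX, Or.inr h1⟩, a', hY, Or.inr ⟨v', by rw [h', h3, h4.1]⟩⟩
  · rintro ⟨b, ⟨a, rfl, ha⟩, a', rfl, ha'⟩
    refine ⟨(b.tree, a), (b.tree, a'), ⟨rfl, ?_⟩, rfl, rfl⟩
    have hne' : a.1 ≠ a'.1 := fun h => hne (congrArg _ (Subtype.ext h))
    rcases ha with ha | ⟨v, ha⟩ <;> rcases ha' with ha' | ⟨v', ha'⟩
    · exact absurd (ha.trans ha'.symm) hne'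
    · exact Or.inl ⟨_, by rw [ha, ha']⟩
    · exact Or.inr (Or.inl ⟨_, by rw [ha, ha']⟩)
    · refine Or.inr (Or.inr ⟨b.top, b.idx, v, v', ?_, ha, ha'⟩)
      rintro rfl
      exact hne' (ha.trans ha'.symm)

theorem card_blockInc_left (hq : 0 < q) (hk : 0 < k) (b : Block t k q) :
    Nat.card {X // BlockInc ht π X b} = k := by
  have h1 : ∀ o : Option (Fin (k - 1)),
      BlockInc ht π (glueMk ht π b.tree (o.elim b.topVertex b.child)) b := by
    rintro (_ | v)
    · exact ⟨_, rfl, Or.inl rfl⟩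
    · exact ⟨_, rfl, Or.inr ⟨v, rfl⟩⟩
  have h2 : Function.Bijective
      (fun o : Option (Fin (k - 1)) => (⟨_, h1 o⟩ : {X // BlockInc ht π X b})) := by
    constructor
    · intro o o' h
      have h3 := congrArg (fun a : TreeVertex t k q => a.1)
        (glueMk_injective hq b.tree (congrArg Subtype.val h))
      rcases o with _ | v <;> rcases o' with _ | v'
      · rfl
      · change b.top = b.top ++ [_] at h3
        simp at h3
      · change b.top ++ [_] = b.top at h3
        simp at h3
      · simpa [Block.child] using h3
    · rintro ⟨_, a, rfl, ha | ⟨v, ha⟩⟩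
      · exact ⟨none, Subtype.ext (congrArg (glueMk ht π b.tree) (Subtype.ext ha.symm))⟩
      · exact ⟨some v, Subtype.ext (congrArg (glueMk ht π b.tree) (Subtype.ext ha.symm))⟩
  rw [← Nat.card_eq_of_bijective _ h2]
  simp
  omega

/-- A leaf is a child in one block of each of the `t` trees; the root is the top of one block in
each tree; any other vertex is a child in one block of its tree and the top of `t - 1` more. -/
theorem card_blockInc_right (hq : 0 < q) (X : Quot (Glue ht k q π)) :
    Nat.card {b // BlockInc ht π X b} = t := by
  obtain ⟨⟨i, a⟩, rfl⟩ := Quot.exists_rep X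
  change Nat.card {b // BlockInc ht π (glueMk ht π i a) b} = t
  by_cases hl : a.1.length = q
  · obtain ⟨j, rfl⟩ := exists_leafVertex ht π i a hl
    have hne : ∀ i', (leafVertex ht π i' j).1 ≠ [] := fun i' h => by
      have := length_leafVertex ht π i' j
      rw [h] at this
      exact hq.ne this
    choose f hf hf' using fun i' => exists_isChild i' (leafVertex ht π i' j) (hne i')
    have h1 : ∀ i', BlockInc ht π (glueMk ht π i (leafVertex ht π i j)) (f i') := fun i' =>
      ⟨leafVertex ht π i' j, by rw [hf]; exact glueMk_leafVertex ht π _ _ _, Or.inr (hf' i')⟩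
    have h2 : Function.Bijective (fun i' => (⟨f i', h1 i'⟩ :
        {b // BlockInc ht π (glueMk ht π i (leafVertex ht π i j)) b})) := by
      constructor
      · intro i1 i2 h
        rw [← hf i1, ← hf i2]
        exact congrArg Block.tree (congrArg Subtype.val h)
      · rintro ⟨b, a', hb, hb'⟩
        refine ⟨b.tree, Subtype.ext ?_⟩
        have hlen := length_eq_of_glueMk_eq hq hb
        rw [length_leafVertex] at hlen
        have hc : b.IsChild a'.1 := hb'.resolve_left fun h => by
          have := b.length_lt
          rw [← h] at this
          omega
        have ha' : a' = leafVertex ht π b.tree j := by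
          rcases glueMk_eq hq hb with h | ⟨j', h1, h2⟩
          · omega
          · rw [h1, leafVertex_injective ht π i h2]
        rw [ha'] at hc
        exact (hf' _).eq hc (hf _)
    rw [← Nat.card_eq_of_bijective _ h2]
    simp
  · have hlt : a.1.length < q := lt_of_le_of_ne a.2.2 hl
    by_cases h0 : a.1 = []
    · obtain rfl : a = treeRoot t k q := Subtype.ext h0
      have h1 : ∀ i', BlockInc ht π (glueMk ht π i (treeRoot t k q))
          ⟨i', [], ⟨0, by omega⟩, by simp [IsLabel], hq, fun _ => rfl⟩ := fun i' =>
        ⟨treeRoot t k q, glueMk_root ht π _ _, Or.inl rfl⟩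
      have h2 : Function.Bijective (fun i' => (⟨_, h1 i'⟩ :
          {b // BlockInc ht π (glueMk ht π i (treeRoot t k q)) b})) := by
        constructor
        · intro i1 i2 h
          exact congrArg Block.tree (congrArg Subtype.val h)
        · rintro ⟨b, a', hb, hb'⟩
          have hlen : a'.1.length = 0 := length_eq_of_glueMk_eq hq hb
          have htop : b.top = [] := by
            rcases hb' with h | h
            · rw [← h]; exact List.length_eq_zero_iff.mp hlen
            · have := h.length; omega
          exact ⟨b.tree, Subtype.ext (Block.ext rfl htop.symm
            (Fin.ext (b.idx_eq_zero htop).symm))⟩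
      rw [← Nat.card_eq_of_bijective _ h2]
      simp
    · obtain ⟨b₀, hb₀, hc₀⟩ := exists_isChild i a h0
      have h1 : ∀ o : Option (Fin (t - 1)), BlockInc ht π (glueMk ht π i a)
          (o.elim b₀ fun u => ⟨i, a.1, u, a.2.1, hlt, fun h => absurd h h0⟩) := by
        rintro (_ | u)
        · exact ⟨a, by rw [← hb₀]; rfl, Or.inr hc₀⟩
        · exact ⟨a, rfl, Or.inl rfl⟩
      have h3 := hc₀.length
      have h2 : Function.Bijective (fun o => (⟨_, h1 o⟩ :
          {b // BlockInc ht π (glueMk ht π i a) b})) := by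
        constructor
        · intro o o' h
          have h4 := congrArg Subtype.val h
          rcases o with _ | u <;> rcases o' with _ | u'
          · rfl
          · have := congrArg (fun b => b.top.length) h4
            simp only [Option.elim_none, Option.elim_some] at this
            omega
          · have := congrArg (fun b => b.top.length) h4
            simp only [Option.elim_none, Option.elim_some] at this
            omega
          · exact congrArg some (congrArg Block.idx h4)
        · rintro ⟨b, a', hb, hb'⟩
          have hlen := length_eq_of_glueMk_eq hq hb
          rcases glueMk_eq hq hb with ⟨rfl, h5, h6⟩ | ⟨j, h5, -⟩
          · have h7 := h6.resolve_left h0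
            rcases hb' with h | h
            · exact ⟨some b.idx, Subtype.ext (Block.ext h7.symm h rfl)⟩
            · exact ⟨none, Subtype.ext (hc₀.eq h (hb₀.trans h7.symm))⟩
          · rw [h5, length_leafVertex] at hlen
            omega
      rw [← Nat.card_eq_of_bijective _ h2]
      simp
      omega

theorem gluedGraph_connected : (gluedGraph ht k q π).Connected := by
  have hreach : ∀ (l : ℕ) (i : Fin t) (a : TreeVertex t k q), a.1.length = l →
      (gluedGraph ht k q π).Reachable (glueMk ht π i a) (glueMk ht π i (treeRoot t k q)) := by
    intro l
    induction l with
    | zero =>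
      intro i a ha
      rw [show a = treeRoot t k q from Subtype.ext (List.length_eq_zero_iff.mp ha)]
    | succ l ih =>
      intro i a ha
      obtain ⟨b, rfl, hb⟩ := exists_isChild i a (by rintro h; simp [h] at ha)
      have hl : b.top.length = l := by have := hb.length; omega
      refine SimpleGraph.Reachable.trans ?_ (ih b.tree b.topVertex hl)
      by_cases he : glueMk ht π b.tree a = glueMk ht π b.tree b.topVertex
      · rw [he]
      · exact ((gluedGraph_adj _ _).mpr
          ⟨he, b, ⟨a, rfl, Or.inr hb⟩, b.topVertex, rfl, Or.inl rfl⟩).reachable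
  have : Nonempty (Quot (Glue ht k q π)) := ⟨glueMk ht π ⟨0, by omega⟩ (treeRoot t k q)⟩
  refine ⟨?_⟩
  rintro ⟨i, a⟩ ⟨i', a'⟩
  have h1 := hreach _ i a rfl
  rw [glueMk_root ht π i i'] at h1
  exact h1.trans (hreach _ i' a' rfl).symm

end Blocks

/-! ### Reduced walks in the glued graph and their projection to clusters. -/

theorem take_eq_take_of_prefix {α : Type*} {p w : List α} {s : ℕ} (h : p <+: w)
    (hs : s ≤ p.length) : w.take s = p.take s := by
  obtain ⟨l, rfl⟩ := h
  exact List.take_append_of_le_length hs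

section BlockWalks

variable {t k q : ℕ}

/-- An infinite reduced walk along blocks; the `m`-th step goes inside the block `b m` from `a m`
to `a' m`. -/
structure IsBlockWalk (ht : 2 ≤ t) (π : Fin t → Equiv.Perm (Fin (levelSize t k q)))
    (b : ℕ → Block t k q) (a a' : ℕ → TreeVertex t k q) : Prop where
  left : ∀ m, (a m).1 = (b m).top ∨ (b m).IsChild (a m).1
  right : ∀ m, (a' m).1 = (b m).top ∨ (b m).IsChild (a' m).1
  ne : ∀ m, a m ≠ a' m
  glue : ∀ m, glueMk ht π (b m).tree (a' m) = glueMk ht π (b (m + 1)).tree (a (m + 1))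
  block_ne : ∀ m, b m ≠ b (m + 1)

variable {ht : 2 ≤ t} {π : Fin t → Equiv.Perm (Fin (levelSize t k q))}
  {b : ℕ → Block t k q} {a a' : ℕ → TreeVertex t k q}

theorem IsBlockWalk.length_eq (hW : IsBlockWalk ht π b a a') (hq : 0 < q) (m : ℕ) :
    (a' m).1.length = (a (m + 1)).1.length := length_eq_of_glueMk_eq hq (hW.glue m)

theorem IsBlockWalk.next (hW : IsBlockWalk ht π b a a') (hq : 0 < q) {m : ℕ}
    (hm : (a' m).1.length < q) : a (m + 1) = a' m := by
  rcases glueMk_eq hq (hW.glue m) with h | ⟨j, h, -⟩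
  · exact h.1.symm
  · rw [h, length_leafVertex] at hm
    omega

theorem IsBlockWalk.next_tree (hW : IsBlockWalk ht π b a a') (hq : 0 < q) {m : ℕ}
    (hm : (a' m).1.length < q) (h0 : (a' m).1 ≠ []) : (b (m + 1)).tree = (b m).tree := by
  rcases glueMk_eq hq (hW.glue m) with h | ⟨j, h, -⟩
  · exact (h.2.2.resolve_left h0).symm
  · rw [h, length_leafVertex] at hm
    omega

/-- A walk that has started to descend keeps descending until the last level: the only block of the
tree in which the current vertex is a child is the one just used, so it must be the top of the next
block. -/
theorem IsBlockWalk.child_next (hW : IsBlockWalk ht π b a a') (hq : 0 < q) {m : ℕ}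
    (hm : (a' m).1.length < q) (h : (b m).IsChild (a' m).1) :
    (a' m).1 = (b (m + 1)).top ∧ (b (m + 1)).IsChild (a' (m + 1)).1 := by
  have h1 := hW.next hq hm
  have h2 : (a' m).1 ≠ [] := fun h0 => by
    have := h.length
    rw [h0] at this
    simp at this
  have h3 : (a (m + 1)).1 = (b (m + 1)).top := (hW.left (m + 1)).resolve_right fun h4 => by
    rw [h1] at h4
    exact hW.block_ne m (h.eq h4 (hW.next_tree hq hm h2).symm)
  refine ⟨h1 ▸ h3, (hW.right (m + 1)).resolve_left fun h4 => ?_⟩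
  exact hW.ne (m + 1) (Subtype.ext (h3.trans h4.symm))

/-- If the last level is never met, then one descending step forces descent forever and the depth
exceeds `q`; if no step ends at a child, every step lowers the depth by one, which is impossible
more than `q` times. -/
theorem IsBlockWalk.exists_leaf (hW : IsBlockWalk ht π b a a') (hq : 0 < q) :
    ∃ m, (a m).1.length = q := by
  by_contra! hno
  have hlt : ∀ m, (a' m).1.length < q := fun m => by
    rw [hW.length_eq hq]
    exact lt_of_le_of_ne (a (m + 1)).2.2 (hno _)
  by_cases hD : ∃ m, (b m).IsChild (a' m).1
  · obtain ⟨m, hm⟩ := hD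
    have key : ∀ d, (b (m + d)).IsChild (a' (m + d)).1 ∧ d ≤ (a' (m + d)).1.length := by
      intro d
      induction d with
      | zero => exact ⟨hm, Nat.zero_le _⟩
      | succ d ih =>
        obtain ⟨h1, h2⟩ := hW.child_next hq (hlt _) ih.1
        refine ⟨h2, ?_⟩
        have := h2.length
        rw [← h1] at this
        have := ih.2
        rw [← Nat.add_assoc]
        omega
    have := (key q).2
    have := hlt (m + q)
    omega
  · push Not at hD
    have key : ∀ d, (a d).1.length + d ≤ q := by
      intro d
      induction d with
      | zero => exact (a 0).2.2
      | succ d ih =>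
        have h1 := (hW.right d).resolve_right (hD d)
        have h2 := (hW.left d).resolve_left fun h =>
          hW.ne d (Subtype.ext (h.trans h1.symm))
        have := h2.length
        rw [← h1, hW.length_eq hq d] at this
        omega
    have := key (q + 1)
    omega

/-- The part of a block walk between two visits to the last level: it first goes up in the
tree, and then leaves the path to the starting point and goes down. -/
theorem IsBlockWalk.excursion (hW : IsBlockWalk ht π b a a') {s L : ℕ} (hs : 0 < s)
    (hsL : s + L < q) {τ : ℕ} (hτ : (a τ).1.length = q) (d : ℕ) (hd : d < L)
    (hno : ∀ e < d, (a' (τ + e)).1.length < q) :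
    (b (τ + d)).tree = (b τ).tree ∧ (b (τ + d)).top.take s = (a τ).1.take s ∧
    s ≤ (b (τ + d)).top.length ∧
    (((a' (τ + d)).1 = (b (τ + d)).top ∧ (b (τ + d)).top.length + d + 1 = q ∧
        ∃ v, (b (τ + d)).top ++ [toLex ((b (τ + d)).idx, v)] <+: (a τ).1) ∨
      ((b (τ + d)).IsChild (a' (τ + d)).1 ∧ ¬ (a' (τ + d)).1 <+: (a τ).1)) := by
  induction d with
  | zero =>
    rw [show τ + 0 = τ from rfl]
    have hc : (b τ).IsChild (a τ).1 := (hW.left τ).resolve_left fun h => by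
      have := (b τ).length_lt
      rw [← h] at this
      omega
    have hlen := hc.length
    refine ⟨rfl, (take_eq_take_of_prefix hc.top_prefix (by omega)).symm, by omega, ?_⟩
    · rcases hW.right τ with h | h
      · obtain ⟨v, hv⟩ := hc
        exact Or.inl ⟨h, by omega, v, hv ▸ List.prefix_rfl⟩
      · refine Or.inr ⟨h, fun hp => hW.ne τ (Subtype.ext ?_)⟩
        exact (hp.eq_of_length (by rw [h.length, hc.length])).symm
  | succ d ih =>
    have hlt := hno d (by omega)
    obtain ⟨htree, htake, hsl, hcase⟩ := ih (by omega) fun e he => hno e (by omega)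
    rw [← Nat.add_assoc]
    have hpre : (b (τ + d)).top <+: (a' (τ + d)).1 := by
      rcases hcase with h | h
      · rw [h.1]
      · exact h.1.top_prefix
    have hle := hpre.length_le
    have htree' := hW.next_tree (by omega) hlt fun h0 => by
      rw [h0, List.length_nil] at hle
      omega
    have htake' : (a' (τ + d)).1.take s = (a τ).1.take s :=
      (take_eq_take_of_prefix hpre hsl).trans htake
    rcases hcase with ⟨h1, h2, v, hv⟩ | ⟨h1, h2⟩
    · have hnext := hW.next (by omega) hlt
      have hx : (a' (τ + d)).1 <+: (a τ).1 := by
        rw [h1]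
        exact (List.prefix_append _ _).trans hv
      -- The walk is still on the path from the starting leaf to the root. It turns down if the
      -- current vertex is the top of the next block; otherwise it moves on to that block's top or
      -- sideways to a sibling.
      rcases hW.left (τ + d + 1) with h3 | h3
      · have h4 : (b (τ + d + 1)).IsChild (a' (τ + d + 1)).1 :=
          (hW.right _).resolve_left fun h => hW.ne _ (Subtype.ext (h3.trans h.symm))
        rw [hnext] at h3
        refine ⟨htree'.trans htree, by rw [← h3, htake'], by rw [← h3, h1]; exact hsl,
          Or.inr ⟨h4, fun hp => ?_⟩⟩
        obtain ⟨v', hv'⟩ := h4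
        rw [hv'] at hp
        -- Descending back towards the starting leaf would use the same copy of $K_{k-1}$ below the
        -- same top, that is, the block just used.
        have h5 := List.prefix_of_prefix_length_le hp hv (by rw [← h3, h1]; simp)
        have h6 := h5.eq_of_length (by rw [← h3, h1]; simp)
        obtain ⟨h7, h8⟩ := List.append_inj' h6 rfl
        simp only [List.cons.injEq, toLex_inj, Prod.mk.injEq, and_true] at h8
        exact hW.block_ne (τ + d) (Block.ext htree'.symm h7.symm h8.1.symm)
      · rw [hnext] at h3
        have h4 := h3.length
        rw [h1] at h4
        refine ⟨htree'.trans htree, ?_, by omega, ?_⟩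
        · rw [← htake', take_eq_take_of_prefix h3.top_prefix (by omega)]
        · rcases hW.right (τ + d + 1) with h5 | h5
          · obtain ⟨v', hv'⟩ := h3
            exact Or.inl ⟨h5, by omega, v', hv' ▸ hx⟩
          · refine Or.inr ⟨h5, fun hp => hW.ne (τ + d + 1) (Subtype.ext ?_)⟩
            rw [hnext]
            have hl : (a' (τ + d)).1.length = (a' (τ + d + 1)).1.length := by
              rw [h3.length, h5.length]
            exact (List.prefix_of_prefix_length_le hx hp hl.le).eq_of_length hl
    · obtain ⟨h3, h4⟩ := hW.child_next (by omega) hlt h1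
      refine ⟨htree'.trans htree, by rw [← h3, htake'], by rw [← h3]; omega,
        Or.inr ⟨h4, fun hp => h2 ?_⟩⟩
      rw [h3]
      exact h4.top_prefix.trans hp

/-- Consecutive visits of a block walk to the last level are in a common cluster, the vertices are
different, and the walk stays in one tree in between. -/
theorem IsBlockWalk.next_leaf (hW : IsBlockWalk ht π b a a') {s L : ℕ} (hs : 0 < s)
    (hsL : s + L < q) {τ : ℕ} (hτ : (a τ).1.length = q) (d : ℕ) (hd : d < L)
    (hno : ∀ e < d, (a' (τ + e)).1.length < q) (hleaf : (a' (τ + d)).1.length = q) :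
    (b (τ + d)).tree = (b τ).tree ∧ (a' (τ + d)).1.take s = (a τ).1.take s ∧
      a' (τ + d) ≠ a τ := by
  obtain ⟨htree, htake, hsl, ⟨h, h1, -⟩ | ⟨h, h1⟩⟩ := hW.excursion hs hsL hτ d hd hno
  · rw [h] at hleaf
    omega
  · refine ⟨htree, (take_eq_take_of_prefix h.top_prefix hsl).trans htake, fun he => h1 ?_⟩
    rw [he]

/-- A leaf lies in a single block of each tree, so a different next block must belong to another
tree. This makes consecutive clusters differ in colour. -/
theorem IsBlockWalk.tree_ne_of_leaf (hW : IsBlockWalk ht π b a a') (hq : 0 < q) {m : ℕ}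
    (hleaf : (a' m).1.length = q) : (b m).tree ≠ (b (m + 1)).tree := by
  intro h
  have h1 := hW.glue m
  rw [h] at h1
  have h2 := glueMk_injective hq _ h1
  have hc : (b m).IsChild (a' m).1 := (hW.right m).resolve_left fun h' => by
    have := (b m).length_lt
    rw [← h'] at this
    omega
  have hc' : (b (m + 1)).IsChild (a (m + 1)).1 := (hW.left (m + 1)).resolve_left fun h' => by
    have := (b (m + 1)).length_lt
    rw [← h', ← h2] at this
    omega
  rw [← h2] at hc'
  exact hW.block_ne m (hc.eq hc' h)

/-- A block walk starting on the last level projects to a reduced chain of clusters. -/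
theorem IsBlockWalk.exists_chain (hW : IsBlockWalk ht π b a a') {s L : ℕ} (hs : 0 < s)
    (hsL : s + L < q) {x : ℕ → Fin (levelSize t k q)}
    (hx : ∀ m, (a m).1.length = q → a m = leafVertex ht π (b m).tree (x m))
    (h0 : (a 0).1.length = q) (T : ℕ) (hT : 0 < T) (hTL : T ≤ L) (hleaf : (a T).1.length = q) :
    ∃ l v c, 0 < l ∧ l ≤ T ∧
      IsReducedChain (ClusterInc fun i j => ((levelOrder ht k q).symm (π i j)).1.take s) l v c ∧
      v 0 = x 0 ∧ v l = x T ∧ (c (l - 1)).1 = (b (T - 1)).tree := by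
  have hq : 0 < q := by omega
  have hx' : ∀ m, (a' m).1.length = q → a' m = leafVertex ht π (b m).tree (x (m + 1)) := by
    intro m hm
    have h1 := hx (m + 1) (by rw [← hW.length_eq hq]; exact hm)
    rcases glueMk_eq hq (hW.glue m) with h | ⟨j, h2, h3⟩
    · omega
    · rw [h2, leafVertex_injective ht π _ (h1.symm.trans h3)]
  -- The induction runs over visits to the last level. The colour of the last cluster is carried
  -- along so that the chain remains reduced when the next cluster is appended.
  induction T using Nat.strong_induction_on with
  | _ T ih =>
  have step : ∀ τ < T, (a τ).1.length = q → (∀ m, τ < m → m < T → (a m).1.length ≠ q) →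
      (b (T - 1)).tree = (b τ).tree ∧
      ((levelOrder ht k q).symm (π (b τ).tree (x T))).1.take s =
        ((levelOrder ht k q).symm (π (b τ).tree (x τ))).1.take s ∧ x τ ≠ x T := by
    intro τ hτT hτ hno
    have hT1 : τ + (T - 1 - τ) = T - 1 := by omega
    have hT2 : T - 1 + 1 = T := by omega
    have hl : (a' (T - 1)).1.length = q := by rw [hW.length_eq hq, hT2, hleaf]
    obtain ⟨h1, h2, h3⟩ := hW.next_leaf hs hsL hτ (T - 1 - τ) (by omega) (fun e he => by
      rw [hW.length_eq hq]
      exact lt_of_le_of_ne (a _).2.2 (hno _ (by omega) (by omega))) (by rw [hT1]; exact hl)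
    rw [hT1] at h1 h2 h3
    rw [hx' _ hl, h1, hx τ hτ, hT2] at h2 h3
    exact ⟨h1, h2, fun h => h3 (by rw [h])⟩
  by_cases hmid : ∃ m, 0 < m ∧ m < T ∧ (a m).1.length = q
  · obtain ⟨τ, ⟨hτ0, hτT, hτ⟩, hmax⟩ : ∃ τ, (0 < τ ∧ τ < T ∧ (a τ).1.length = q) ∧
        ∀ m, τ < m → m < T → (a m).1.length ≠ q := by
      classical
      let P := fun m => 0 < m ∧ m < T ∧ (a m).1.length = q
      obtain ⟨m, hm⟩ := hmid
      refine ⟨Nat.findGreatest P T, Nat.findGreatest_spec (P := P) hm.2.1.le hm, ?_⟩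
      intro m' hm' hm'T hq'
      exact Nat.findGreatest_is_greatest hm' hm'T.le ⟨by omega, hm'T, hq'⟩
    obtain ⟨l, v, c, hl, hlτ, hch, hv0, hvl, hc⟩ := ih τ hτT hτ0 (by omega) hτ
    obtain ⟨h1, h2, h3⟩ := step τ hτT hτ hmax
    refine ⟨l + 1, _, _, by omega, by omega, hch.snoc (y := x T)
      (c := ((b τ).tree, ((levelOrder ht k q).symm (π (b τ).tree (x τ))).1.take s))
      (by rw [hvl]; rfl) h2 (by rw [hvl]; exact h3) ?_, by simpa using hv0, by simp, ?_⟩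
    · intro m hm he
      obtain rfl : m = l - 1 := by omega
      have h4 := hW.tree_ne_of_leaf hq (m := τ - 1)
        (by rw [hW.length_eq hq, Nat.sub_add_cancel hτ0, hτ])
      rw [Nat.sub_add_cancel hτ0, ← hc, he] at h4
      exact h4 rfl
    · simp [h1]
  · push Not at hmid
    obtain ⟨h1, h2, h3⟩ := step 0 hT h0 fun m h h' => hmid m h h'
    refine ⟨1, fun m => if m = 0 then x 0 else x T,
      fun _ => ((b 0).tree, ((levelOrder ht k q).symm (π (b 0).tree (x 0))).1.take s),
      one_pos, hT, ⟨?_, ?_, ?_, ?_⟩, rfl, rfl, h1.symm⟩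
    · intro m hm
      obtain rfl : m = 0 := by omega
      rfl
    · intro m hm
      obtain rfl : m = 0 := by omega
      exact h2
    · intro m hm
      obtain rfl : m = 0 := by omega
      exact h3
    · intro m hm
      omega

/-- If the clusters have large girth, so has the glued graph. -/
theorem girthGT_blockInc {s L : ℕ} (hs : 0 < s) (hsL : s + L < q)
    (hg : GirthGT (ClusterInc fun i j => ((levelOrder ht k q).symm (π i j)).1.take s) L) :
    GirthGT (BlockInc ht π) L := by
  have hq : 0 < q := by omega
  refine girthGT_of_periodic fun n v b hn hnL hch hper => ?_
  have hl : ∀ m, BlockInc ht π (v m) (b m) := fun m => (hch (m + 1)).left m (by omega)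
  have hr : ∀ m, BlockInc ht π (v (m + 1)) (b m) := fun m => (hch (m + 1)).right m (by omega)
  choose a ha hab using hl
  choose a' ha' hab' using hr
  have hW : IsBlockWalk ht π b a a' := ⟨hab, hab', fun m he => (hch (m + 1)).ne m (by omega) (by
      rw [← ha, ← ha', he]), fun m => by rw [ha, ha'],
    fun m => (hch (m + 2)).block_ne m (by omega)⟩
  -- By periodicity the closed chain may be restarted at a leaf, to which it returns after `n`
  -- steps.
  obtain ⟨m₀, hm₀⟩ := hW.exists_leaf hq
  have hW' : IsBlockWalk ht π (fun m => b (m₀ + m)) (fun m => a (m₀ + m))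
      (fun m => a' (m₀ + m)) :=
    ⟨fun m => hW.left _, fun m => hW.right _, fun m => hW.ne _, fun m => hW.glue (m₀ + m),
      fun m => hW.block_ne (m₀ + m)⟩
  have hglue : glueMk ht π (b (m₀ + n)).tree (a (m₀ + n)) = glueMk ht π (b m₀).tree (a m₀) := by
    rw [ha, ha, hper]
  have hex : ∀ m, ∃ x, (a (m₀ + m)).1.length = q →
      a (m₀ + m) = leafVertex ht π (b (m₀ + m)).tree x := by
    intro m
    by_cases h : (a (m₀ + m)).1.length = q
    · obtain ⟨x, hx⟩ := exists_leafVertex ht π (b (m₀ + m)).tree _ h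
      exact ⟨x, fun _ => hx⟩
    · obtain ⟨x, -⟩ := exists_leafVertex ht π (b m₀).tree _ hm₀
      exact ⟨x, fun h' => absurd h' h⟩
  choose x hx using hex
  have hleaf : (a (m₀ + n)).1.length = q := by rw [length_eq_of_glueMk_eq hq hglue, hm₀]
  obtain ⟨l, y, c, hl, hln, hc, hy0, hyl, -⟩ :=
    hW'.exists_chain hs hsL hx hm₀ n hn hnL hleaf
  apply hg l y c hl (by omega) hc
  rw [hy0, hyl]
  have h1 := hx 0 hm₀
  have h2 := hx n hleaf
  rw [Nat.add_zero] at h1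
  rcases glueMk_eq hq hglue with h | ⟨j, h3, h4⟩
  · omega
  · rw [leafVertex_injective ht π _ (h1.symm.trans h4),
      leafVertex_injective ht π _ (h2.symm.trans h3)]

/-- If the clusters have large girth, the permutations are distinct. -/
theorem injective_of_girthGT {s L : ℕ} (hs : 0 < s) (hsq : s < q) (hL : 2 ≤ L) (ht3 : 3 ≤ t)
    (hk : 2 ≤ k)
    (hg : GirthGT (ClusterInc fun i j => ((levelOrder ht k q).symm (π i j)).1.take s) L) :
    Function.Injective π := by
  intro i i' hii
  by_contra hne
  -- `p` is a parent of leaves. As `t ≥ 3` it has children in two different copies, and as `s < q`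
  -- these leaves share a cluster. If `π i = π i'`, they would share clusters of two colours,
  -- contradicting `block_unique`.
  let p : List (Column t k) := List.replicate (q - 1) (toLex (⟨0, by omega⟩, ⟨0, by omega⟩))
  have hp : IsLabel p := by
    intro c hc
    rw [List.eq_of_mem_replicate (List.mem_of_mem_head? hc)]
    rfl
  have hpl : p.length = q - 1 := List.length_replicate
  have hp0 : p ≠ [] := fun h => by
    rw [h] at hpl
    simp at hpl
    omega
  have hlab : ∀ u : Fin (t - 1), IsLabel (p ++ [toLex (u, (⟨0, by omega⟩ : Fin (k - 1)))]) ∧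
      (p ++ [toLex (u, (⟨0, by omega⟩ : Fin (k - 1)))]).length = q := fun u =>
    ⟨isLabel_append hp (fun h => absurd h hp0) _, by simp [hpl]; omega⟩
  let w : Fin (t - 1) → Level t k q := fun u => ⟨_, hlab u⟩
  let j : Fin (t - 1) → Fin (levelSize t k q) := fun u => (π i).symm (levelOrder ht k q (w u))
  have hj : ∀ u, (levelOrder ht k q).symm (π i (j u)) = w u := fun u => by simp [j]
  have htake : ∀ u, (w u).1.take s = p.take s := fun u =>
    List.take_append_of_le_length (by omega)
  have hne01 : j ⟨0, by omega⟩ ≠ j ⟨1, by omega⟩ := by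
    intro h
    have h1 : w ⟨0, by omega⟩ = w ⟨1, by omega⟩ := by rw [← hj, h, hj]
    have h2 := congrArg Subtype.val h1
    simp [w] at h2
  have hinc : ∀ u, ClusterInc (fun i j => ((levelOrder ht k q).symm (π i j)).1.take s) (j u)
      (i, p.take s) := fun u => by
    change ((levelOrder ht k q).symm (π i (j u))).1.take s = _
    rw [hj, htake]
  have hinc' : ∀ u, ClusterInc (fun i j => ((levelOrder ht k q).symm (π i j)).1.take s) (j u)
      (i', p.take s) := fun u => by
    have := hinc u
    rw [ClusterInc] at this ⊢
    rw [← this, hii]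
  exact hne (congrArg Prod.fst
    (hg.block_unique hL hne01 (hinc _) (hinc _) (hinc' _) (hinc' _)))

end BlockWalks

end TreeGluing

theorem theorem9 (t k g : ℕ) (hk : 2 ≤ k) (hkt : k < t) (hkg : k < g) :
    ∃ q₀ : ℕ, ∀ q : ℕ, q₀ ≤ q →
      ∃ π : Fin t → Equiv.Perm (Fin (TreeGluing.levelSize t k q)), Function.Injective π ∧
        (TreeGluing.gluedGraph (hk.trans hkt.le) k q π).Connected ∧
        TreeGluing.HasConstantLink (TreeGluing.gluedGraph (hk.trans hkt.le) k q π)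
          (TreeGluing.copies t (⊤ : SimpleGraph (Fin (k - 1)))) ∧
        ∀ h : ℕ, k < h → h < g →
          ¬ TreeGluing.HasCycleOfLength (TreeGluing.gluedGraph (hk.trans hkt.le) k q π) h := by
  open TreeGluing in
  -- The girth bound is `g` itself; `g > k ≥ 2` gives the bound 3 needed for the links.
  obtain ⟨q₀, hq₀⟩ := exists_leaf_labelling (t := t) (k := k) (by omega) hk g
  refine ⟨q₀, fun q hq => ?_⟩
  obtain ⟨s, hs, hsq, β, hβ⟩ := hq₀ q hq
  have ht : 2 ≤ t := hk.trans hkt.le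
  have hg : GirthGT (ClusterInc fun i j => ((levelOrder ht k q).symm
      (((β i).trans (levelOrder ht k q).toEquiv) j)).1.take s) g := by
    simpa using hβ
  have hG := girthGT_blockInc hs hsq hg
  refine ⟨_, injective_of_girthGT hs (by omega) (by omega) (by omega) hk hg,
    gluedGraph_connected,
    hG.hasConstantLink (by omega) gluedGraph_adj hk (by omega)
      (card_blockInc_right (by omega)) (card_blockInc_left (by omega) (by omega)),
    fun h hkh hhg => hG.not_hasCycleOfLength (fun X Y hXY => ((gluedGraph_adj X Y).mp hXY).2)
      (by omega) (card_blockInc_left (by omega) (by omega)) hkh hhg.le⟩
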